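/- Let $0<\alpha\le 2$ and $\lambda>0$. A random vector $(X_1,X_2)$ is symmetric $\alpha$-stable ($S\alpha S$) if there is a finite symmetric Borel measure $\Gamma$ (a spectral measure) on the Euclidean unit circle $S_2\subset\mathbb R^2$ with $E\exp\{i(t_1X_1+t_2X_2)\}=\exp\{-\int_{S_2}|t_1s_1+t_2s_2|^\alpha\,\Gamma(ds)\}$ for all $(t_1,t_2)\in\mathbb R^2$; its $\alpha$-covariance is $\rho(X_1,X_2)=\int_{S_2}s_1s_2\,\Gamma(ds)$. Let $M$ be an $S\alpha S$ random measure on $\mathbb R$ with Lebesgue control measure, that is, an independently scattered, almost surely $\sigma$-additive random set function on the Borel sets $A$ of finite Lebesgue measure $|A|$ with $E e^{i\theta M(A)}=e^{-|A||\theta|^\alpha}$ for $\theta\in\mathbb R$. Let $$X(t)=\int_{-\infty}^t e^{-\lambda(t-x)}\,M(dx),\qquad t\in\mathbb R,$$ be the $S\alpha S$ Ornstein–Uhlenbeck process, the stochastic integral of a function in $L^\alpha(\mathbb R)$ being the limit in probability of the integrals of simple functions that converge to it in $L^\alpha(\mathbb R)$. Put $\rho(t)=\rho(X(0),X(t))$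 and $\bar\rho(t)=\rho(t)/\rho(0)$. Then for every $t\in\mathbb R$ the vector $(X(0),X(t))$ is $S\alpha S$, and $\rho(t)$ does not depend on the choice of its spectral measure. For every $t>0$, $$\rho(t)=\frac{1}{\alpha\lambda\,(1+e^{-2\lambda t})^{(2-\alpha)/2}}\,e^{-\lambda t},\qquad \bar\rho(t)=\frac{1}{\bigl(\tfrac12(1+e^{-2\lambda t})\bigr)^{(2-\alpha)/2}}\,e^{-\lambda t}.$$ Consequently $\bar\rho(t)\sim 2^{(2-\alpha)/2}e^{-\lambda t}$ as $t\to\infty$, i.e. the ratio of the two sides tends to $1$. -/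

import Mathlib

open MeasureTheory ProbabilityTheory Filter Topology Asymptotics

/-- The unit sphere of `ℝ^d` (Euclidean norm). -/
abbrev UnitSphere (d : ℕ) : Type := Metric.sphere (0 : EuclideanSpace ℝ (Fin d)) 1

/-- `Γ` is a spectral measure of the symmetric `α`-stable law `ν` on `ℝ^d`: a finite symmetric
Borel measure on the unit sphere such that the characteristic function of `ν` is
`t ↦ exp (-∫ |(t, s)|^α Γ(ds))`. -/
structure IsSpectralMeasure (α : ℝ) {d : ℕ} (ν : Measure (EuclideanSpace ℝ (Fin d)))
    (Γ : Measure (UnitSphere d)) : Prop where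
  finite : IsFiniteMeasure Γ
  symmetric : Γ.map (fun s => -s) = Γ
  charFun_eq : ∀ t : EuclideanSpace ℝ (Fin d),
    charFun ν t =
      Complex.exp (-((∫ s, |inner ℝ t (s : EuclideanSpace ℝ (Fin d))| ^ α ∂Γ : ℝ) : ℂ))

/-- A law on `ℝ^d` is symmetric `α`-stable if it has a spectral measure. -/
def IsSymmStable (α : ℝ) {d : ℕ} (ν : Measure (EuclideanSpace ℝ (Fin d))) : Prop :=
  ∃ Γ : Measure (UnitSphere d), IsSpectralMeasure α ν Γ

open Classical in
/-- The spectral measure of a symmetric `α`-stable law (zero if the law is not such). -/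
noncomputable def spectralMeasure (α : ℝ) {d : ℕ} (ν : Measure (EuclideanSpace ℝ (Fin d))) :
    Measure (UnitSphere d) :=
  if h : IsSymmStable α ν then h.choose else 0

/-- The integral `∫ s₁ s₂ Γ(ds)` over the unit circle. -/
noncomputable def mixedMoment (Γ : Measure (UnitSphere 2)) : ℝ :=
  ∫ s, (s : EuclideanSpace ℝ (Fin 2)) 0 * (s : EuclideanSpace ℝ (Fin 2)) 1 ∂Γ

/-- The joint law on the Euclidean plane of two real random variables. -/
noncomputable def jointLaw {Ω : Type*} [MeasurableSpace Ω] (P : Measure Ω) (X Y : Ω → ℝ) :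
    Measure (EuclideanSpace ℝ (Fin 2)) :=
  P.map (fun ω => !₂[X ω, Y ω])

/-- The `α`-covariance `ρ(X, Y) = ∫ s₁ s₂ Γ(ds)`, with `Γ` the spectral measure of `(X, Y)`. -/
noncomputable def alphaCovariance {Ω : Type*} [MeasurableSpace Ω] (α : ℝ) (P : Measure Ω)
    (X Y : Ω → ℝ) : ℝ :=
  mixedMoment (spectralMeasure α (jointLaw P X Y))

/-- `M` is a symmetric `α`-stable random measure with control measure `m`: an independently
scattered, almost surely `σ`-additive random set function on the measurable sets of finite
`m`-measure, such that `M A` has characteristic function `θ ↦ exp (-m(A) |θ|^α)`.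
The values of `M` on other sets play no role. The series in `sigma_additive` need not converge
absolutely, so its sum is the limit of the partial sums. -/
structure IsSymmStableRandomMeasure {E Ω : Type*} [MeasurableSpace E] [MeasurableSpace Ω]
    (α : ℝ) (m : Measure E) (P : Measure Ω) (M : Set E → Ω → ℝ) : Prop where
  measurable : ∀ A, MeasurableSet A → m A < ⊤ → Measurable (M A)
  charFun_eq : ∀ A, MeasurableSet A → m A < ⊤ → ∀ θ : ℝ,
    charFun (P.map (M A)) θ = Complex.exp (-((m.real A * |θ| ^ α : ℝ) : ℂ))
  independent : ∀ (k : ℕ) (A : Fin k → Set E), (∀ i, MeasurableSet (A i)) →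
    (∀ i, m (A i) < ⊤) → Pairwise (fun i j => Disjoint (A i) (A j)) →
    iIndepFun (fun i => M (A i)) P
  sigma_additive : ∀ A : ℕ → Set E, (∀ j, MeasurableSet (A j)) → m (⋃ j, A j) < ⊤ →
    Pairwise (fun i j => Disjoint (A i) (A j)) →
    ∀ᵐ ω ∂P, Tendsto (fun n => ∑ j ∈ Finset.range n, M (A j) ω) atTop (𝓝 (M (⋃ j, A j) ω))

/-- The integral `∑ y, y * M {φ = y}` of a simple function (the term with `y = 0` vanishes). -/
noncomputable def simpleStableIntegral {E Ω : Type*} [MeasurableSpace E]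
    (M : Set E → Ω → ℝ) (φ : SimpleFunc E ℝ) (ω : Ω) : ℝ :=
  ∑ y ∈ φ.range, y * M (φ ⁻¹' {y}) ω

/-- The random variable `Y` is (a version of) the stochastic integral `∫ f dM` of
`f ∈ L^α(E, m)`: the limit in probability of the integrals of simple functions with support of
finite measure that converge to `f` in `L^α(E, m)`. -/
structure IsStableIntegral {E Ω : Type*} [MeasurableSpace E] [MeasurableSpace Ω]
    (α : ℝ) (m : Measure E) (P : Measure Ω) (M : Set E → Ω → ℝ) (f : E → ℝ) (Y : Ω → ℝ) :
    Prop where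
  memLp : MemLp f (ENNReal.ofReal α) m
  measurable : Measurable Y
  exists_approx : ∃ φ : ℕ → SimpleFunc E ℝ,
    (∀ n, (φ n).FinMeasSupp m) ∧
    Tendsto (fun n => eLpNorm (fun x => φ n x - f x) (ENNReal.ofReal α) m) atTop (𝓝 0) ∧
    TendstoInMeasure P (fun n => simpleStableIntegral M (φ n)) atTop Y

/-- The Ornstein–Uhlenbeck kernel `x ↦ exp (-lam (t - x)) 1_{x ≤ t}`. -/
noncomputable def ouKernel (lam t : ℝ) : ℝ → ℝ :=
  (Set.Iic t).indicator (fun x => Real.exp (-lam * (t - x)))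

/-- `X` is the symmetric `α`-stable Ornstein–Uhlenbeck process
`X(t) = ∫_{-∞}^t exp (-lam (t - x)) M(dx)`, for `M` a symmetric `α`-stable random measure on `ℝ`
with Lebesgue control measure. -/
structure IsStableOU {Ω : Type*} [MeasurableSpace Ω] (α lam : ℝ) (P : Measure Ω)
    (M : Set ℝ → Ω → ℝ) (X : ℝ → Ω → ℝ) : Prop where
  randomMeasure : IsSymmStableRandomMeasure α volume P M
  integral : ∀ t : ℝ, IsStableIntegral α volume P M (ouKernel lam t) (X t)

/-- The `α`-covariance function `ρ(t) = ρ(X(0), X(t))` of a process. -/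
noncomputable def alphaCovFun {Ω : Type*} [MeasurableSpace Ω] (α : ℝ) (P : Measure Ω)
    (X : ℝ → Ω → ℝ) (t : ℝ) : ℝ :=
  alphaCovariance α P (X 0) (X t)

/-- The normalised `α`-covariance function `ρ(t) / ρ(0)` of a process. -/
noncomputable def normAlphaCovFun {Ω : Type*} [MeasurableSpace Ω] (α : ℝ) (P : Measure Ω)
    (X : ℝ → Ω → ℝ) (t : ℝ) : ℝ :=
  alphaCovFun α P X t / alphaCovFun α P X 0

/-! For stable integrals X = ∫ f dM and Y = ∫ g dM the characteristic function at t is exp(-∫ |t₀ f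
+ t₁ g|^α dm): independence gives it for simple functions, and L^α approximation carries it over
(`charFun_jointLaw_eq`). Let s ≤ t and c = e^{-λ(t-s)}. On x ≤ s the kernel of X(t) is c times that
of X(s); on (s, t] only the later kernel survives. Hence the exponent is (αλ)⁻¹ (|t₀ + c t₁|^α + (1
- c^α) |t₁|^α), and a spectral measure sits on the directions ±(1, c) and ±(0, 1). The second pair
adds nothing to ∫ s₁ s₂ dΓ; the first gives (αλ)⁻¹ (1 + c²)^{(α-2)/2} c.

The α-covariance is defined through a chosen spectral measure, which is not unique when α = 2, so
independence of the choice needs proof. Integrating ∫ |(t, s)|^α Γ(ds) against sin 2θ over t = (cos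
θ, sin θ) yields 2κ ∫ s₁ s₂ dΓ with κ = ∫ |cos u|^α cos 2u du > 0, by a Funk–Hecke computation. The
law thus determines the mixed moment for every α > 0 (`IsSpectralMeasure.mixedMoment_eq`). -/

/-! ### Finite additivity and integrals of simple functions. -/

namespace IsSymmStableRandomMeasure

variable {E Ω : Type*} [MeasurableSpace E] [MeasurableSpace Ω] {α : ℝ} {m : Measure E}
  {P : Measure Ω} {M : Set E → Ω → ℝ}

/-- For the constant sequence ∅ the partial sums are n · M ∅. They converge, so their constant
increment M ∅ is zero. -/
theorem ae_empty (hM : IsSymmStableRandomMeasure α m P M) : ∀ᵐ ω ∂P, M ∅ ω = 0 := by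
  have h := hM.sigma_additive (fun _ => ∅) (fun _ => MeasurableSet.empty) (by simp)
    (fun i j _ => disjoint_bot_left)
  filter_upwards [h] with ω hω
  simp only [Set.iUnion_empty, Finset.sum_const, Finset.card_range, nsmul_eq_mul] at hω
  have h1 := (tendsto_add_atTop_iff_nat 1).2 hω
  have h2 := h1.sub hω
  have h3 : (fun n : ℕ => ((n + 1 : ℕ) : ℝ) * M ∅ ω - (n : ℝ) * M ∅ ω) = fun _ => M ∅ ω := by
    funext n; push_cast; ring
  rw [h3, sub_self] at h2
  exact tendsto_nhds_unique tendsto_const_nhds h2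

theorem ae_union (hM : IsSymmStableRandomMeasure α m P M) {A B : Set E} (hA : MeasurableSet A)
    (hB : MeasurableSet B) (hAB : Disjoint A B) (hfin : m (A ∪ B) < ⊤) :
    ∀ᵐ ω ∂P, M (A ∪ B) ω = M A ω + M B ω := by
  let C : ℕ → Set E := fun n => if n = 0 then A else if n = 1 then B else ∅
  have hU : ⋃ j, C j = A ∪ B := by
    ext x
    simp only [Set.mem_iUnion, Set.mem_union, C]
    constructor
    · rintro ⟨j, hj⟩
      split_ifs at hj <;> simp_all
    · rintro (h | h)
      · exact ⟨0, by simpa using h⟩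
      · exact ⟨1, by simpa using h⟩
  have h := hM.sigma_additive C (fun j => by dsimp only [C]; split_ifs <;> simp [hA, hB])
    (by rwa [hU]) (fun i j hij => by
      dsimp only [C]
      split_ifs <;> simp_all [hAB.symm])
  rw [hU] at h
  filter_upwards [h, hM.ae_empty] with ω hω h0
  have h1 := (tendsto_add_atTop_iff_nat 2).2 hω
  have h2 : (fun n => ∑ j ∈ Finset.range (n + 2), M (C j) ω) = fun _ => M A ω + M B ω := by
    funext n
    rw [Finset.sum_range_succ', Finset.sum_range_succ']
    simp [C, h0, add_comm]
  rw [h2] at h1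
  exact tendsto_nhds_unique h1 tendsto_const_nhds

theorem ae_biUnion (hM : IsSymmStableRandomMeasure α m P M) {ι : Type*} (s : Finset ι)
    (A : ι → Set E) (hA : ∀ i, MeasurableSet (A i)) (hd : Pairwise (fun i j => Disjoint (A i) (A j)))
    (hfin : ∀ i ∈ s, m (A i) < ⊤) :
    ∀ᵐ ω ∂P, M (⋃ i ∈ s, A i) ω = ∑ i ∈ s, M (A i) ω := by
  classical
  induction s using Finset.induction_on with
  | empty => simpa using hM.ae_empty
  | insert i s his ih =>
    have h1 : m (⋃ j ∈ s, A j) < ⊤ :=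
      measure_biUnion_lt_top s.finite_toSet (fun j hj => hfin j (Finset.mem_insert_of_mem hj))
    have h2 := hM.ae_union (hA i) (s.measurableSet_biUnion fun j _ => hA j)
      (Set.disjoint_iUnion₂_right.2 fun j hj => hd (by rintro rfl; exact his hj))
      ((measure_union_le _ _).trans_lt
        (ENNReal.add_lt_top.2 ⟨hfin i (Finset.mem_insert_self i s), h1⟩))
    filter_upwards [h2, ih fun j hj => hfin j (Finset.mem_insert_of_mem hj)] with ω h3 h4
    rw [Finset.set_biUnion_insert, h3, h4, Finset.sum_insert his]

/-- This lets two simple functions be integrated over one common partition, that of their pair. The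
zero level may have infinite measure, where M is uncontrolled; `h 0 = 0` removes it. -/
theorem ae_simpleStableIntegral_map (hM : IsSymmStableRandomMeasure α m P M) {F : Type*} [Zero F]
    (p : SimpleFunc E F) (hp : p.FinMeasSupp m) (h : F → ℝ) (h0 : h 0 = 0) :
    ∀ᵐ ω ∂P, simpleStableIntegral M (p.map h) ω = ∑ q ∈ p.range, h q * M (p ⁻¹' {q}) ω := by
  classical
  have key : ∀ᵐ ω ∂P, ∀ y ∈ p.range.image h, y ≠ 0 →
      M (p.map h ⁻¹' {y}) ω = ∑ q ∈ p.range with h q = y, M (p ⁻¹' {q}) ω := by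
    refine (Filter.eventually_all_finset _).2 fun y _ => ?_
    by_cases hy : y = 0
    · exact Eventually.of_forall fun ω h => absurd hy h
    have h1 := hM.ae_biUnion (p.range.filter fun q => h q = y) (fun q => p ⁻¹' {q})
      (fun q => p.measurableSet_preimage _)
      (fun i j hij => Disjoint.preimage _ (by simpa using hij))
      (fun q hq => SimpleFunc.finMeasSupp_iff.1 hp q (by
        rintro rfl
        exact hy ((Finset.mem_filter.1 hq).2.symm.trans h0)))
    have h2 : (⋃ q ∈ p.range.filter fun q => h q = y, p ⁻¹' {q}) = p.map h ⁻¹' {y} := by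
      ext x
      simp
    rw [h2] at h1
    filter_upwards [h1] with ω hω _ using hω
  filter_upwards [key] with ω hω
  rw [simpleStableIntegral, SimpleFunc.range_map,
    ← Finset.sum_fiberwise_of_maps_to (s := p.range) (t := p.range.image h) (g := h)
      (fun q hq => Finset.mem_image_of_mem h hq)]
  refine Finset.sum_congr rfl fun y hy => ?_
  by_cases hy0 : y = 0
  · rw [hy0, zero_mul, Finset.sum_eq_zero]
    intro q hq
    rw [(Finset.mem_filter.1 hq).2, zero_mul]
  · rw [hω y hy hy0, Finset.mul_sum]
    refine Finset.sum_congr rfl fun q hq => ?_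
    rw [(Finset.mem_filter.1 hq).2]

theorem charFun_sum_eq (hM : IsSymmStableRandomMeasure α m P M) [IsProbabilityMeasure P]
    (hα : 0 < α) {F : Type*} [NormedAddCommGroup F]
    (p : SimpleFunc E F) (hp : p.FinMeasSupp m) (h : F → ℝ) (h0 : h 0 = 0) :
    charFun (P.map fun ω => ∑ q ∈ p.range, h q * M (p ⁻¹' {q}) ω) 1 =
      Complex.exp (-((∫ x, |h (p x)| ^ α ∂m : ℝ) : ℂ)) := by
  classical
  set s := p.range.erase 0 with hs
  have hfin : ∀ q : s, m (p ⁻¹' {(q : F)}) < ⊤ := fun q =>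
    SimpleFunc.finMeasSupp_iff.1 hp q (Finset.ne_of_mem_erase q.2)
  have hmeas : ∀ q : s, Measurable (M (p ⁻¹' {(q : F)})) := fun q =>
    hM.measurable _ (p.measurableSet_preimage _) (hfin q)
  have hind : iIndepFun (fun q : s => M (p ⁻¹' {(q : F)})) P := by
    have := (hM.independent _ (fun i => p ⁻¹' {(s.equivFin.symm i : F)})
      (fun i => p.measurableSet_preimage _) (fun i => hfin _)
      (fun i j hij => Disjoint.preimage _ (by simpa [Subtype.ext_iff] using hij))).precomp
        s.equivFin.injective
    simpa [Function.comp_def] using this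
  have hind2 : iIndepFun (fun (q : s) ω => h q * M (p ⁻¹' {(q : F)}) ω) P :=
    hind.comp (fun q x => h q * x) (fun q => measurable_const_mul _)
  have hsum : (fun ω => ∑ q ∈ p.range, h q * M (p ⁻¹' {q}) ω) =
      fun ω => ∑ q : s, h q * M (p ⁻¹' {(q : F)}) ω := by
    funext ω
    rw [Finset.sum_coe_sort s (fun q => h q * M (p ⁻¹' {q}) ω), hs]
    by_cases hz : (0 : F) ∈ p.range
    · rw [← Finset.add_sum_erase _ _ hz, h0, zero_mul, zero_add]
    · rw [Finset.erase_eq_of_notMem hz]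
  have hint : ∫ x, |h (p x)| ^ α ∂m = ∑ q : s, m.real (p ⁻¹' {(q : F)}) * |h q| ^ α := by
    have hg0 : |h 0| ^ α = 0 := by rw [h0, abs_zero, Real.zero_rpow hα.ne']
    have hfs : (p.map fun q => |h q| ^ α).FinMeasSupp m := hp.map hg0
    have hsub : (∫ x, |h (p x)| ^ α ∂m) = ∫ x, (p.map fun q => |h q| ^ α) x ∂m := rfl
    rw [hsub, ← SimpleFunc.integral_eq_integral _ (SimpleFunc.integrable_iff_finMeasSupp.2 hfs),
      SimpleFunc.map_integral p _ (SimpleFunc.integrable_iff_finMeasSupp.2 hp) hg0,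
      Finset.sum_coe_sort s (fun q => m.real (p ⁻¹' {q}) * |h q| ^ α), hs]
    by_cases hz : (0 : F) ∈ p.range
    · rw [← Finset.add_sum_erase _ _ hz, hg0, smul_zero, zero_add]
      rfl
    · rw [Finset.erase_eq_of_notMem hz]
      rfl
  rw [hsum, hind2.charFun_map_fun_sum_eq_prod (fun q => ((hmeas q).const_mul _).aemeasurable),
    Finset.prod_apply, hint, Complex.ofReal_sum, ← Finset.sum_neg_distrib, Complex.exp_sum]
  refine Finset.prod_congr rfl fun q _ => ?_
  rw [charFun_map_mul_comp (hmeas q).aemeasurable, mul_one,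
    hM.charFun_eq _ (p.measurableSet_preimage _) (hfin q)]

end IsSymmStableRandomMeasure

/-! ### Convergence in L^α, including α < 1. -/

section LpConvergence

variable {E : Type*} [MeasurableSpace E] {α : ℝ} {m : Measure E}

theorem integral_abs_rpow_eq_eLpNorm (hα : 0 < α) {u : E → ℝ}
    (hu : MemLp u (ENNReal.ofReal α) m) :
    ∫ x, |u x| ^ α ∂m = (eLpNorm u (ENNReal.ofReal α) m).toReal ^ α := by
  have hnn : 0 ≤ ∫ x, |u x| ^ α ∂m := integral_nonneg fun x => by positivity
  rw [hu.eLpNorm_eq_integral_rpow_norm (by simpa using hα) ENNReal.ofReal_ne_top,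
    ENNReal.toReal_ofReal hα.le]
  simp only [Real.norm_eq_abs]
  rw [ENNReal.toReal_ofReal (by positivity), ← Real.rpow_mul hnn, inv_mul_cancel₀ hα.ne',
    Real.rpow_one]

theorem integrable_abs_rpow (hα : 0 < α) {u : E → ℝ} (hu : MemLp u (ENNReal.ofReal α) m) :
    Integrable (fun x => |u x| ^ α) m := by
  have := hu.integrable_norm_rpow (by simpa using hα) ENNReal.ofReal_ne_top
  simpa [ENNReal.toReal_ofReal hα.le] using this

theorem abs_abs_rpow_sub_le (hα : 0 < α) (hα1 : α ≤ 1) (x y : ℝ) :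
    |(|x| ^ α - |y| ^ α)| ≤ |x - y| ^ α := by
  have key : ∀ x y : ℝ, |x| ^ α ≤ |x - y| ^ α + |y| ^ α := fun x y => by
    refine le_trans ?_ (Real.rpow_add_le_add_rpow (abs_nonneg _) (abs_nonneg _) hα.le hα1)
    refine Real.rpow_le_rpow (abs_nonneg _) ?_ hα.le
    simpa using abs_add_le (x - y) y
  have h1 := key x y
  have h2 := key y x
  rw [abs_sub_comm y x] at h2
  rw [abs_le]
  constructor <;> linarith

theorem tendsto_integral_abs_rpow (hα : 0 < α) {u : ℕ → E → ℝ} {v : E → ℝ}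
    (hu : ∀ n, MemLp (u n) (ENNReal.ofReal α) m) (hv : MemLp v (ENNReal.ofReal α) m)
    (h : Tendsto (fun n => eLpNorm (u n - v) (ENNReal.ofReal α) m) atTop (𝓝 0)) :
    Tendsto (fun n => ∫ x, |u n x| ^ α ∂m) atTop (𝓝 (∫ x, |v x| ^ α ∂m)) := by
  -- For α ≥ 1 the norm is continuous on L^α; for α ≤ 1 subadditivity of r ↦ r^α replaces the
  -- triangle inequality.
  rcases le_total 1 α with h1 | h1
  · have : Fact (1 ≤ ENNReal.ofReal α) := ⟨by simpa using h1⟩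
    have h2 := (Lp.tendsto_Lp_iff_tendsto_eLpNorm'' u hu v hv).2 h
    have h3 := h2.norm
    simp only [Lp.norm_toLp] at h3
    simp only [integral_abs_rpow_eq_eLpNorm hα (hu _), integral_abs_rpow_eq_eLpNorm hα hv]
    exact h3.rpow_const (Or.inr hα.le)
  · have h2 : Tendsto (fun n => (eLpNorm (u n - v) (ENNReal.ofReal α) m).toReal ^ α) atTop (𝓝 0) := by
      have := ((ENNReal.tendsto_toReal ENNReal.zero_ne_top).comp h).rpow_const
        (p := α) (Or.inr hα.le)
      simpa [Real.zero_rpow hα.ne'] using this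
    rw [tendsto_iff_dist_tendsto_zero]
    refine squeeze_zero (fun _ => dist_nonneg) (fun n => ?_) h2
    rw [← integral_abs_rpow_eq_eLpNorm hα ((hu n).sub hv), Real.dist_eq,
      ← integral_sub (integrable_abs_rpow hα (hu n)) (integrable_abs_rpow hα hv)]
    refine (abs_integral_le_integral_abs).trans (integral_mono_of_nonneg
      (Eventually.of_forall fun _ => abs_nonneg _) (integrable_abs_rpow hα ((hu n).sub hv))
      (Eventually.of_forall fun x => abs_abs_rpow_sub_le hα h1 _ _))

theorem tendsto_eLpNorm_lin_comb {p : ENNReal} (a b : ℝ) {u v : ℕ → E → ℝ}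
    (hu : ∀ n, AEStronglyMeasurable (u n) m) (hv : ∀ n, AEStronglyMeasurable (v n) m)
    (hu0 : Tendsto (fun n => eLpNorm (u n) p m) atTop (𝓝 0))
    (hv0 : Tendsto (fun n => eLpNorm (v n) p m) atTop (𝓝 0)) :
    Tendsto (fun n => eLpNorm (a • u n + b • v n) p m) atTop (𝓝 0) := by
  have h1 : Tendsto (fun n => ENNReal.LpAddConst p * (‖a‖ₑ * eLpNorm (u n) p m + ‖b‖ₑ * eLpNorm (v n) p m))
      atTop (𝓝 0) := by
    have ha := ENNReal.Tendsto.const_mul (a := ‖a‖ₑ) hu0 (Or.inr enorm_ne_top)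
    have hb := ENNReal.Tendsto.const_mul (a := ‖b‖ₑ) hv0 (Or.inr enorm_ne_top)
    have := ENNReal.Tendsto.const_mul (a := ENNReal.LpAddConst p) (ha.add hb)
      (Or.inr (ENNReal.LpAddConst_lt_top p).ne)
    simpa using this
  refine tendsto_of_tendsto_of_tendsto_of_le_of_le tendsto_const_nhds h1 (fun _ => zero_le) ?_
  intro n
  have := eLpNorm_add_le' ((hu n).const_smul a) ((hv n).const_smul b) p
  simpa only [eLpNorm_const_smul] using this

end LpConvergence

/-! ### Characteristic functions of pairs of stable integrals. -/

section JointLaw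

variable {Ω : Type*} [MeasurableSpace Ω] {P : Measure Ω}

theorem inner_plane (t s : EuclideanSpace ℝ (Fin 2)) : inner ℝ t s = t 0 * s 0 + t 1 * s 1 := by
  simp [PiLp.inner_apply, Fin.sum_univ_two, mul_comm]

theorem charFun_jointLaw {X Y : Ω → ℝ} (hX : Measurable X) (hY : Measurable Y)
    (t : EuclideanSpace ℝ (Fin 2)) :
    charFun (jointLaw P X Y) t =
      ∫ ω, Complex.exp (((t 0 * X ω + t 1 * Y ω : ℝ) : ℂ) * Complex.I) ∂P := by
  have hm : Measurable fun ω => (!₂[X ω, Y ω] : EuclideanSpace ℝ (Fin 2)) := by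
    refine (PiLp.continuous_toLp 2 _).measurable.comp (measurable_pi_lambda _ fun i => ?_)
    fin_cases i
    · exact hX
    · exact hY
  rw [charFun_apply, jointLaw, integral_map hm.aemeasurable (by fun_prop)]
  refine integral_congr_ae (Eventually.of_forall fun ω => ?_)
  simp only [inner_plane]
  simp [mul_comm]

end JointLaw

theorem IsSymmStableRandomMeasure.aemeasurable_simpleStableIntegral {E Ω : Type*} [MeasurableSpace E]
    [MeasurableSpace Ω] {α : ℝ} {m : Measure E} {P : Measure Ω} {M : Set E → Ω → ℝ}
    (hM : IsSymmStableRandomMeasure α m P M)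
    {φ : SimpleFunc E ℝ} (hφ : φ.FinMeasSupp m) : AEMeasurable (simpleStableIntegral M φ) P := by
  unfold simpleStableIntegral
  refine Finset.aemeasurable_fun_sum _ fun y _ => ?_
  by_cases hy : y = 0
  · simp [hy]
  · exact ((hM.measurable _ (SimpleFunc.measurableSet_preimage _ _)
      (SimpleFunc.finMeasSupp_iff.1 hφ y hy)).const_mul _).aemeasurable

namespace IsStableIntegral

variable {E Ω : Type*} [MeasurableSpace E] [MeasurableSpace Ω] {α : ℝ} {m : Measure E}
  {P : Measure Ω} [IsProbabilityMeasure P] {M : Set E → Ω → ℝ}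

theorem charFun_simple_lin_comb (hM : IsSymmStableRandomMeasure α m P M) (hα : 0 < α)
    {φ ψ : SimpleFunc E ℝ} (hφ : φ.FinMeasSupp m) (hψ : ψ.FinMeasSupp m) (a b : ℝ) :
    ∫ ω, Complex.exp (((a * simpleStableIntegral M φ ω + b * simpleStableIntegral M ψ ω : ℝ) : ℂ)
        * Complex.I) ∂P = Complex.exp (-((∫ x, |a * φ x + b * ψ x| ^ α ∂m : ℝ) : ℂ)) := by
  have hp := hφ.pair hψ
  refine Eq.trans ?_ (hM.charFun_sum_eq hα _ hp (fun q => a * q.1 + b * q.2) (by simp))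
  rw [charFun_apply_real]
  have hmeas : AEMeasurable (fun ω => ∑ q ∈ (φ.pair ψ).range,
      (a * q.1 + b * q.2) * M (φ.pair ψ ⁻¹' {q}) ω) P := by
    refine Finset.aemeasurable_fun_sum _ fun q _ => ?_
    by_cases hq : q = 0
    · simp [hq]
    · exact ((hM.measurable _ (SimpleFunc.measurableSet_preimage _ _)
        (SimpleFunc.finMeasSupp_iff.1 hp q hq)).const_mul _).aemeasurable
  rw [integral_map hmeas (by fun_prop)]
  refine integral_congr_ae ?_
  filter_upwards [hM.ae_simpleStableIntegral_map _ hp Prod.fst rfl,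
    hM.ae_simpleStableIntegral_map _ hp Prod.snd rfl] with ω h1 h2
  rw [SimpleFunc.map_fst_pair] at h1
  rw [SimpleFunc.map_snd_pair] at h2
  rw [h1, h2, Finset.mul_sum, Finset.mul_sum, ← Finset.sum_add_distrib]
  simp only [Complex.ofReal_one, one_mul]
  congr 3
  exact Finset.sum_congr rfl fun q _ => by ring

theorem charFun_jointLaw_eq (hM : IsSymmStableRandomMeasure α m P M) (hα : 0 < α) {f g : E → ℝ}
    {X Y : Ω → ℝ} (hX : IsStableIntegral α m P M f X) (hY : IsStableIntegral α m P M g Y)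
    (t : EuclideanSpace ℝ (Fin 2)) :
    charFun (jointLaw P X Y) t =
      Complex.exp (-((∫ x, |t 0 * f x + t 1 * g x| ^ α ∂m : ℝ) : ℂ)) := by
  obtain ⟨φ, hφ, hφf, hφX⟩ := hX.exists_approx
  obtain ⟨ψ, hψ, hψg, hψY⟩ := hY.exists_approx
  rw [charFun_jointLaw hX.measurable hY.measurable]
  have hφL : ∀ n, MemLp (φ n) (ENNReal.ofReal α) m := fun n =>
    SimpleFunc.memLp_of_finite_measure_preimage _ fun y hy => SimpleFunc.finMeasSupp_iff.1 (hφ n) y hy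
  have hψL : ∀ n, MemLp (ψ n) (ENNReal.ofReal α) m := fun n =>
    SimpleFunc.memLp_of_finite_measure_preimage _ fun y hy => SimpleFunc.finMeasSupp_iff.1 (hψ n) y hy
  have hint : Tendsto (fun n => ∫ x, |t 0 * φ n x + t 1 * ψ n x| ^ α ∂m) atTop
      (𝓝 (∫ x, |t 0 * f x + t 1 * g x| ^ α ∂m)) := by
    refine tendsto_integral_abs_rpow hα
      (fun n => ((hφL n).const_mul (t 0)).add ((hψL n).const_mul (t 1)))
      ((hX.memLp.const_mul (t 0)).add (hY.memLp.const_mul (t 1))) ?_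
    have := tendsto_eLpNorm_lin_comb (t 0) (t 1)
      (fun n => ((hφL n).sub hX.memLp).aestronglyMeasurable)
      (fun n => ((hψL n).sub hY.memLp).aestronglyMeasurable) hφf hψg
    refine this.congr fun n => ?_
    congr 1
    funext x
    simp
    ring
  have hlim : Tendsto (fun n => Complex.exp (-((∫ x, |t 0 * φ n x + t 1 * ψ n x| ^ α ∂m : ℝ) : ℂ)))
      atTop (𝓝 (Complex.exp (-((∫ x, |t 0 * f x + t 1 * g x| ^ α ∂m : ℝ) : ℂ)))) :=
    (Complex.continuous_exp.tendsto _).comp ((Complex.continuous_ofReal.tendsto _).comp hint).neg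
  -- The second subsequence is extracted from the first, so that both integrals converge almost
  -- surely along it; the integrands have modulus 1, so dominated convergence applies.
  obtain ⟨n₁, hn₁, h₁⟩ := hφX.exists_seq_tendsto_ae
  obtain ⟨n₂, hn₂, h₂⟩ := (hψY.comp hn₁.tendsto_atTop).exists_seq_tendsto_ae
  have hns : Tendsto (fun k => n₁ (n₂ k)) atTop atTop :=
    hn₁.tendsto_atTop.comp hn₂.tendsto_atTop
  refine tendsto_nhds_unique ?_ (hlim.comp hns)
  have hdct : Tendsto (fun k => ∫ ω, Complex.exp (((t 0 * simpleStableIntegral M (φ (n₁ (n₂ k))) ω +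
      t 1 * simpleStableIntegral M (ψ (n₁ (n₂ k))) ω : ℝ) : ℂ) * Complex.I) ∂P) atTop
      (𝓝 (∫ ω, Complex.exp (((t 0 * X ω + t 1 * Y ω : ℝ) : ℂ) * Complex.I) ∂P)) := by
    refine tendsto_integral_of_dominated_convergence (fun _ => 1) (fun k => ?_)
      (integrable_const 1) (fun k => Eventually.of_forall fun ω => ?_) ?_
    · have h := ((hM.aemeasurable_simpleStableIntegral (hφ (n₁ (n₂ k)))).const_mul (t 0)).add
        ((hM.aemeasurable_simpleStableIntegral (hψ (n₁ (n₂ k)))).const_mul (t 1))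
      exact (Complex.measurable_exp.comp_aemeasurable
        ((Complex.measurable_ofReal.comp_aemeasurable h).mul_const _)).aestronglyMeasurable
    · rw [Complex.norm_exp_ofReal_mul_I]
    · filter_upwards [h₁, h₂] with ω hω₁ hω₂
      have h := ((hω₁.comp hn₂.tendsto_atTop).const_mul (t 0)).add (hω₂.const_mul (t 1))
      exact (Complex.continuous_exp.tendsto _).comp
        (((Complex.continuous_ofReal.tendsto _).comp h).mul_const _)
  refine hdct.congr fun k => ?_
  rw [charFun_simple_lin_comb hM hα (hφ _) (hψ _)]
  rfl

end IsStableIntegral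

/-! ### The mixed moment is determined by the law. -/

section FunkHecke

theorem continuous_abs_cos_rpow {α : ℝ} (hα : 0 < α) :
    Continuous fun u : ℝ => |Real.cos u| ^ α :=
  Real.continuous_cos.abs.rpow_const fun _ => Or.inr hα.le

/-- Adding the integrand to its shift by π/2 gives (|cos u|^α - |sin u|^α)(cos² u - sin² u), whose
factors have the same sign, and which equals 1 at u = 0. -/
theorem integral_abs_cos_rpow_mul_cos_pos {α : ℝ} (hα : 0 < α) :
    0 < ∫ u in (0 : ℝ)..(2 * Real.pi), |Real.cos u| ^ α * Real.cos (2 * u) := by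
  set F : ℝ → ℝ := fun u => |Real.cos u| ^ α * Real.cos (2 * u) with hF
  have hFc : Continuous F := (continuous_abs_cos_rpow hα).mul (by fun_prop)
  have hper : Function.Periodic F (2 * Real.pi) := fun u => by
    simp only [hF, Real.cos_add_two_pi]
    rw [show 2 * (u + 2 * Real.pi) = 2 * u + 2 * Real.pi + 2 * Real.pi by ring,
      Real.cos_add_two_pi, Real.cos_add_two_pi]
  have hshift : ∫ u in (0 : ℝ)..(2 * Real.pi), F u =
      ∫ u in (0 : ℝ)..(2 * Real.pi), F (u + Real.pi / 2) := by
    rw [intervalIntegral.integral_comp_add_right, zero_add, add_comm (2 * Real.pi)]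
    simpa using hper.intervalIntegral_add_eq 0 (Real.pi / 2)
  have hsum : (∫ u in (0 : ℝ)..(2 * Real.pi), F u) + ∫ u in (0 : ℝ)..(2 * Real.pi), F u =
      ∫ u in (0 : ℝ)..(2 * Real.pi), (F u + F (u + Real.pi / 2)) := by
    conv_lhs => rhs; rw [hshift]
    rw [intervalIntegral.integral_add (hFc.intervalIntegrable _ _)
      (Continuous.intervalIntegrable (by fun_prop) _ _)]
  have hG : ∀ u, F u + F (u + Real.pi / 2) =
      (|Real.cos u| ^ α - |Real.sin u| ^ α) * (|Real.cos u| ^ 2 - |Real.sin u| ^ 2) := fun u => by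
    simp only [hF, Real.cos_add_pi_div_two, abs_neg]
    rw [show 2 * (u + Real.pi / 2) = 2 * u + Real.pi by ring, Real.cos_add_pi, Real.cos_two_mul',
      sq_abs, sq_abs]
    ring
  have hpos : 0 < ∫ u in (0 : ℝ)..(2 * Real.pi), (F u + F (u + Real.pi / 2)) := by
    refine intervalIntegral.integral_pos (by positivity)
      (hFc.add (hFc.comp (continuous_id.add continuous_const))).continuousOn (fun u _ => ?_)
      ⟨0, ⟨le_rfl, by positivity⟩, ?_⟩
    · rw [hG]
      rcases le_total |Real.cos u| |Real.sin u| with h | h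
      · exact mul_nonneg_of_nonpos_of_nonpos
          (sub_nonpos.2 (Real.rpow_le_rpow (abs_nonneg _) h hα.le))
          (sub_nonpos.2 (pow_le_pow_left₀ (abs_nonneg _) h 2))
      · exact mul_nonneg (sub_nonneg.2 (Real.rpow_le_rpow (abs_nonneg _) h hα.le))
          (sub_nonneg.2 (pow_le_pow_left₀ (abs_nonneg _) h 2))
    · rw [hG]
      simp [Real.zero_rpow hα.ne']
  linarith

/-- The integrand is odd under u ↦ 2π - u. -/
theorem integral_abs_cos_rpow_mul_sin (α : ℝ) :
    ∫ u in (0 : ℝ)..(2 * Real.pi), |Real.cos u| ^ α * Real.sin (2 * u) = 0 := by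
  set F : ℝ → ℝ := fun u => |Real.cos u| ^ α * Real.sin (2 * u) with hF
  have h : ∫ u in (0 : ℝ)..(2 * Real.pi), F u = -∫ u in (0 : ℝ)..(2 * Real.pi), F u := by
    rw [← intervalIntegral.integral_neg]
    have := intervalIntegral.integral_comp_sub_left F (2 * Real.pi) (a := 0) (b := 2 * Real.pi)
    rw [sub_zero, sub_self] at this
    rw [← this]
    refine intervalIntegral.integral_congr fun u _ => ?_
    simp only [hF, Real.cos_two_pi_sub]
    rw [show 2 * (2 * Real.pi - u) = -(2 * u) + 2 * Real.pi + 2 * Real.pi by ring,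
      Real.sin_add_two_pi, Real.sin_add_two_pi, Real.sin_neg]
    ring
  linarith

/-- With (a, b) = (cos φ, sin φ), the rotation θ = u + φ splits sin 2θ into a part that integrates
to zero and sin 2φ cos 2u, where sin 2φ = 2ab. -/
theorem integral_abs_rpow_mul_sin {α : ℝ} (hα : 0 < α) {a b : ℝ} (hab : a ^ 2 + b ^ 2 = 1) :
    ∫ θ in (0 : ℝ)..(2 * Real.pi), |Real.cos θ * a + Real.sin θ * b| ^ α * Real.sin (2 * θ) =
      2 * (∫ u in (0 : ℝ)..(2 * Real.pi), |Real.cos u| ^ α * Real.cos (2 * u)) * (a * b) := by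
  obtain ⟨φ, rfl, rfl⟩ : ∃ φ, a = Real.cos φ ∧ b = Real.sin φ := by
    have h1 : ‖(⟨a, b⟩ : ℂ)‖ = 1 := by
      rw [← sq_eq_sq₀ (norm_nonneg _) zero_le_one, Complex.sq_norm, Complex.normSq_mk]
      linarith
    obtain ⟨φ, hφ⟩ := Complex.norm_eq_one_iff _ |>.1 h1
    refine ⟨φ, ?_, ?_⟩
    · rw [← Complex.exp_ofReal_mul_I_re, hφ]
    · rw [← Complex.exp_ofReal_mul_I_im, hφ]
  set F : ℝ → ℝ := fun u => |Real.cos u| ^ α * Real.sin (2 * (u + φ)) with hF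
  have hper : Function.Periodic F (2 * Real.pi) := fun u => by
    simp only [hF, Real.cos_add_two_pi]
    rw [show 2 * (u + 2 * Real.pi + φ) = 2 * (u + φ) + 2 * Real.pi + 2 * Real.pi by ring,
      Real.sin_add_two_pi, Real.sin_add_two_pi]
  have h1 : ∀ θ, |Real.cos θ * Real.cos φ + Real.sin θ * Real.sin φ| ^ α * Real.sin (2 * θ) =
      F (θ - φ) := fun θ => by
    simp only [hF, Real.cos_sub, sub_add_cancel]
  simp only [h1]
  rw [intervalIntegral.integral_comp_sub_right, show 2 * Real.pi - φ = 0 - φ + 2 * Real.pi by ring,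
    hper.intervalIntegral_add_eq (0 - φ) 0, zero_add]
  have h2 : ∀ u, F u = Real.cos (2 * φ) * (|Real.cos u| ^ α * Real.sin (2 * u)) +
      Real.sin (2 * φ) * (|Real.cos u| ^ α * Real.cos (2 * u)) := fun u => by
    simp only [hF]
    rw [mul_add, Real.sin_add]
    ring
  simp only [h2]
  have hc := continuous_abs_cos_rpow hα
  rw [intervalIntegral.integral_add, intervalIntegral.integral_const_mul,
    intervalIntegral.integral_const_mul, integral_abs_cos_rpow_mul_sin α, Real.sin_two_mul]
  · ring
  · exact (Continuous.intervalIntegrable (by fun_prop) _ _)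
  · exact (Continuous.intervalIntegrable (by fun_prop) _ _)

theorem unitSphere_sq_add_sq (s : UnitSphere 2) :
    (s : EuclideanSpace ℝ (Fin 2)) 0 ^ 2 + (s : EuclideanSpace ℝ (Fin 2)) 1 ^ 2 = 1 := by
  have h := EuclideanSpace.real_norm_sq_eq (s : EuclideanSpace ℝ (Fin 2))
  rw [norm_eq_of_mem_sphere, Fin.sum_univ_two] at h
  linarith

theorem integral_spectral_mul_sin {α : ℝ} (hα : 0 < α) (Γ : Measure (UnitSphere 2))
    [IsFiniteMeasure Γ] :
    ∫ θ in (0 : ℝ)..(2 * Real.pi), (∫ s, |inner ℝ (!₂[Real.cos θ, Real.sin θ])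
        (s : EuclideanSpace ℝ (Fin 2))| ^ α ∂Γ) * Real.sin (2 * θ) =
      2 * (∫ u in (0 : ℝ)..(2 * Real.pi), |Real.cos u| ^ α * Real.cos (2 * u)) *
        mixedMoment Γ := by
  have hpi : (0 : ℝ) ≤ 2 * Real.pi := by positivity
  rw [mixedMoment, ← integral_const_mul]
  simp only [inner_plane, ← integral_mul_const, intervalIntegral.integral_of_le hpi]
  rw [integral_integral_swap]
  · refine integral_congr_ae (Eventually.of_forall fun s => ?_)
    dsimp only
    rw [← intervalIntegral.integral_of_le hpi, ← intervalIntegral.integral_of_le hpi,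
      ← integral_abs_rpow_mul_sin hα (unitSphere_sq_add_sq s)]
    simp
  · refine Integrable.of_bound (C := 2 ^ α) ?_ (Eventually.of_forall fun q => ?_)
    · refine Continuous.aestronglyMeasurable ?_
      refine Continuous.mul (Continuous.rpow_const ?_ fun _ => Or.inr hα.le) (by fun_prop)
      simp
      fun_prop
    · obtain ⟨θ, s⟩ := q
      have hs := unitSphere_sq_add_sq s
      simp only [Function.uncurry_apply_pair, norm_mul, Real.norm_eq_abs]
      rw [abs_of_nonneg (Real.rpow_nonneg (abs_nonneg _) _)]
      refine (mul_le_of_le_one_right (by positivity) (Real.abs_sin_le_one _)).trans ?_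
      refine Real.rpow_le_rpow (abs_nonneg _) ?_ hα.le
      have h3 := Real.cos_sq_add_sin_sq θ
      simp
      rw [abs_le]
      constructor <;> nlinarith [sq_nonneg (Real.cos θ - s.1 0), sq_nonneg (Real.cos θ + s.1 0),
        sq_nonneg (Real.sin θ - s.1 1), sq_nonneg (Real.sin θ + s.1 1)]

theorem IsSpectralMeasure.mixedMoment_eq {α : ℝ} (hα : 0 < α)
    {ν : Measure (EuclideanSpace ℝ (Fin 2))} {Γ Γ' : Measure (UnitSphere 2)}
    (h : IsSpectralMeasure α ν Γ) (h' : IsSpectralMeasure α ν Γ') :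
    mixedMoment Γ = mixedMoment Γ' := by
  have := h.finite
  have := h'.finite
  have heq : ∀ t : EuclideanSpace ℝ (Fin 2),
      ∫ s, |inner ℝ t (s : EuclideanSpace ℝ (Fin 2))| ^ α ∂Γ =
        ∫ s, |inner ℝ t (s : EuclideanSpace ℝ (Fin 2))| ^ α ∂Γ' := fun t => by
    have h1 := (h.charFun_eq t).symm.trans (h'.charFun_eq t)
    rw [← Complex.ofReal_neg, ← Complex.ofReal_neg, ← Complex.ofReal_exp, ← Complex.ofReal_exp,
      Complex.ofReal_inj] at h1
    exact neg_injective (Real.exp_injective h1)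
  have h1 := integral_spectral_mul_sin hα Γ
  simp only [heq] at h1
  rw [integral_spectral_mul_sin hα Γ'] at h1
  have hc := integral_abs_cos_rpow_mul_cos_pos hα
  exact (mul_left_cancel₀ (by positivity) h1).symm

end FunkHecke

/-! ### Spectral measures carried by two antipodal pairs. -/

section Atoms

/-- The symmetric measure of total mass `c` carried by `u` and `-u`. -/
noncomputable def symmAtom {d : ℕ} (u : UnitSphere d) (c : ℝ) : Measure (UnitSphere d) :=
  ENNReal.ofReal (c / 2) • (Measure.dirac u + Measure.dirac (-u))

instance {d : ℕ} (u : UnitSphere d) (c : ℝ) : IsFiniteMeasure (symmAtom u c) := by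
  unfold symmAtom
  exact Measure.smul_finite _ ENNReal.ofReal_ne_top

theorem map_neg_symmAtom {d : ℕ} (u : UnitSphere d) (c : ℝ) :
    (symmAtom u c).map (fun s => -s) = symmAtom u c := by
  have hm : Measurable fun s : UnitSphere d => -s := continuous_neg.measurable
  rw [symmAtom, Measure.map_smul, Measure.map_add _ _ hm, Measure.map_dirac' hm,
    Measure.map_dirac' hm, neg_neg, add_comm]

theorem integrable_symmAtom {d : ℕ} (u : UnitSphere d) (c : ℝ) (f : UnitSphere d → ℝ) :
    Integrable f (symmAtom u c) :=
  ((integrable_dirac (by simp)).add_measure (integrable_dirac (by simp))).smul_measure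
    ENNReal.ofReal_ne_top

theorem integral_symmAtom {d : ℕ} (u : UnitSphere d) {c : ℝ} (hc : 0 ≤ c) {f : UnitSphere d → ℝ}
    (hf : f (-u) = f u) : ∫ s, f s ∂symmAtom u c = c * f u := by
  rw [symmAtom, integral_smul_measure, integral_add_measure (integrable_dirac (by simp))
    (integrable_dirac (by simp)), integral_dirac, integral_dirac, hf,
    ENNReal.toReal_ofReal (by positivity), smul_eq_mul]
  ring

/-- Each vector is normalised to the circle. Homogeneity of degree α puts ‖x‖^α into the mass, and
s₁ s₂, of degree 2, takes back ‖x‖². -/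
theorem exists_isSpectralMeasure_of_two_atoms {α : ℝ} {ν : Measure (EuclideanSpace ℝ (Fin 2))}
    {x y : EuclideanSpace ℝ (Fin 2)} (hx : x ≠ 0) (hy : y ≠ 0) {A B : ℝ} (hA : 0 ≤ A) (hB : 0 ≤ B)
    (h : ∀ t : EuclideanSpace ℝ (Fin 2), charFun ν t =
      Complex.exp (-((A * |inner ℝ t x| ^ α + B * |inner ℝ t y| ^ α : ℝ) : ℂ))) :
    ∃ Γ : Measure (UnitSphere 2), IsSpectralMeasure α ν Γ ∧
      mixedMoment Γ = A * ‖x‖ ^ (α - 2) * (x 0 * x 1) + B * ‖y‖ ^ (α - 2) * (y 0 * y 1) := by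
  have hx' : 0 < ‖x‖ := norm_pos_iff.2 hx
  have hy' : 0 < ‖y‖ := norm_pos_iff.2 hy
  have hu : ∀ z : EuclideanSpace ℝ (Fin 2), z ≠ 0 → ‖z‖⁻¹ • z ∈ Metric.sphere 0 1 := fun z hz => by
    simp [norm_smul, hz]
  have hscale : ∀ (z : EuclideanSpace ℝ (Fin 2)) (C : ℝ) (hz : z ≠ 0)
      (t : EuclideanSpace ℝ (Fin 2)),
      C * ‖z‖ ^ α * |inner ℝ t (‖z‖⁻¹ • z)| ^ α = C * |inner ℝ t z| ^ α := fun z C hz t => by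
    have hz' : 0 < ‖z‖ := norm_pos_iff.2 hz
    rw [inner_smul_right, abs_mul, abs_of_pos (inv_pos.2 hz'),
      Real.mul_rpow (by positivity) (abs_nonneg _), Real.inv_rpow hz'.le]
    field_simp [(Real.rpow_pos_of_pos hz' α).ne']
  have hmoment : ∀ (z : EuclideanSpace ℝ (Fin 2)) (C : ℝ) (hz : z ≠ 0),
      C * ‖z‖ ^ α * ((‖z‖⁻¹ • z) 0 * (‖z‖⁻¹ • z) 1) = C * ‖z‖ ^ (α - 2) * (z 0 * z 1) :=
    fun z C hz => by
      have hz' : 0 < ‖z‖ := norm_pos_iff.2 hz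
      rw [Real.rpow_sub hz', Real.rpow_two]
      simp only [PiLp.smul_apply, smul_eq_mul]
      field_simp
  have hAx : 0 ≤ A * ‖x‖ ^ α := by positivity
  have hBy : 0 ≤ B * ‖y‖ ^ α := by positivity
  refine ⟨symmAtom ⟨_, hu x hx⟩ (A * ‖x‖ ^ α) + symmAtom ⟨_, hu y hy⟩ (B * ‖y‖ ^ α),
    ⟨inferInstance, ?_, fun t => ?_⟩, ?_⟩
  · rw [Measure.map_add _ _ continuous_neg.measurable, map_neg_symmAtom, map_neg_symmAtom]
  · rw [h t, integral_add_measure (integrable_symmAtom _ _ _) (integrable_symmAtom _ _ _),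
      integral_symmAtom _ hAx (by simp), integral_symmAtom _ hBy (by simp), hscale x A hx,
      hscale y B hy]
  · rw [mixedMoment, integral_add_measure (integrable_symmAtom _ _ _) (integrable_symmAtom _ _ _),
      integral_symmAtom _ hAx (by simp), integral_symmAtom _ hBy (by simp), ← hmoment x A hx,
      ← hmoment y B hy]

theorem mixedMoment_spectralMeasure {α : ℝ} (hα : 0 < α) {ν : Measure (EuclideanSpace ℝ (Fin 2))}
    {Γ : Measure (UnitSphere 2)} (h : IsSpectralMeasure α ν Γ) :
    mixedMoment Γ = mixedMoment (spectralMeasure α ν) := by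
  have hν : IsSymmStable α ν := ⟨Γ, h⟩
  refine h.mixedMoment_eq hα ?_
  rw [spectralMeasure, dif_pos hν]
  exact hν.choose_spec

end Atoms

/-! ### The Ornstein–Uhlenbeck kernels and their α-covariance. -/

section OrnsteinUhlenbeck

theorem ouKernel_eq (lam t : ℝ) : ouKernel lam t =
    (Set.Iic t).indicator fun x => Real.exp (-lam * t) * Real.exp (lam * x) := by
  funext x
  simp only [ouKernel, ← Real.exp_add]
  congr 2
  funext x
  congr 1
  ring

theorem integrable_ouKernel {lam : ℝ} (hlam : 0 < lam) (t : ℝ) : Integrable (ouKernel lam t) := by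
  rw [ouKernel_eq, integrable_indicator_iff measurableSet_Iic]
  exact (integrableOn_exp_mul_Iic hlam t).const_mul _

theorem integral_ouKernel {lam : ℝ} (hlam : 0 < lam) (t : ℝ) : ∫ x, ouKernel lam t x = 1 / lam := by
  rw [ouKernel_eq, integral_indicator measurableSet_Iic, integral_const_mul,
    integral_exp_mul_Iic hlam, mul_div_assoc', ← Real.exp_add]
  simp

/-- The α-th power of a kernel of rate λ is the kernel of rate αλ. The last bracket is the later
such kernel restricted to (s, t]. -/
theorem abs_lin_comb_ouKernel_rpow {α : ℝ} (hα : 0 < α) (lam : ℝ) {s t : ℝ} (hst : s ≤ t)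
    (a b x : ℝ) :
    |a * ouKernel lam s x + b * ouKernel lam t x| ^ α =
      |a + b * Real.exp (-lam * (t - s))| ^ α * ouKernel (α * lam) s x +
        |b| ^ α * (ouKernel (α * lam) t x -
          Real.exp (-lam * (t - s)) ^ α * ouKernel (α * lam) s x) := by
  have hpow : ∀ r, Real.exp (-lam * (r - x)) ^ α = Real.exp (-(α * lam) * (r - x)) := fun r => by
    rw [← Real.exp_mul]
    congr 1
    ring
  have hmul : Real.exp (-lam * (t - x)) =
      Real.exp (-lam * (t - s)) * Real.exp (-lam * (s - x)) := by
    rw [← Real.exp_add]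
    congr 1
    ring
  rcases le_or_gt x s with hxs | hxs
  · have hxt : x ≤ t := hxs.trans hst
    simp only [ouKernel, Set.indicator_of_mem (Set.mem_Iic.2 hxs),
      Set.indicator_of_mem (Set.mem_Iic.2 hxt), ← hpow]
    rw [hmul, ← Real.mul_rpow (Real.exp_pos _).le (Real.exp_pos _).le, sub_self, mul_zero,
      add_zero, ← mul_assoc, ← add_mul, abs_mul, abs_of_pos (Real.exp_pos (-lam * (s - x))),
      Real.mul_rpow (abs_nonneg _) (Real.exp_pos _).le]
  · have hs : x ∉ Set.Iic s := by simpa using hxs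
    rcases le_or_gt x t with hxt | hxt
    · simp only [ouKernel, Set.indicator_of_notMem hs, Set.indicator_of_mem (Set.mem_Iic.2 hxt),
        ← hpow, mul_zero, zero_add, sub_zero]
      rw [abs_mul, abs_of_pos (Real.exp_pos _), Real.mul_rpow (abs_nonneg _) (Real.exp_pos _).le]
    · have ht : x ∉ Set.Iic t := by simpa using hxt
      simp [ouKernel, Set.indicator_of_notMem hs, Set.indicator_of_notMem ht,
        Real.zero_rpow hα.ne']

theorem integral_abs_lin_comb_ouKernel_rpow {α lam : ℝ} (hα : 0 < α) (hlam : 0 < lam) {s t : ℝ}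
    (hst : s ≤ t) (a b : ℝ) :
    ∫ x, |a * ouKernel lam s x + b * ouKernel lam t x| ^ α =
      1 / (α * lam) * |a + b * Real.exp (-lam * (t - s))| ^ α +
        1 / (α * lam) * (1 - Real.exp (-lam * (t - s)) ^ α) * |b| ^ α := by
  have hal : 0 < α * lam := mul_pos hα hlam
  have hs := integrable_ouKernel hal s
  have ht := integrable_ouKernel hal t
  have hd : Integrable fun x => ouKernel (α * lam) t x -
      Real.exp (-lam * (t - s)) ^ α * ouKernel (α * lam) s x := ht.sub (hs.const_mul _)
  simp only [abs_lin_comb_ouKernel_rpow hα lam hst]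
  rw [integral_add (hs.const_mul _) (hd.const_mul _), integral_const_mul,
    integral_const_mul, integral_sub ht (hs.const_mul _), integral_const_mul,
    integral_ouKernel hal, integral_ouKernel hal]
  ring

variable {Ω : Type*} [MeasurableSpace Ω] {P : Measure Ω} [IsProbabilityMeasure P] {α lam : ℝ}
  {M : Set ℝ → Ω → ℝ} {X : ℝ → Ω → ℝ}

theorem one_sub_exp_rpow_nonneg (hα : 0 < α) (hlam : 0 < lam) {r : ℝ} (hr : 0 ≤ r) :
    0 ≤ 1 - Real.exp (-lam * r) ^ α :=
  sub_nonneg.2 (Real.rpow_le_one (Real.exp_pos _).le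
    (Real.exp_le_one_iff.2 (by nlinarith)) hα.le)

theorem IsStableOU.exists_isSpectralMeasure (hX : IsStableOU α lam P M X) (hα : 0 < α)
    (hlam : 0 < lam) {s t : ℝ} (hst : s ≤ t) :
    ∃ Γ, IsSpectralMeasure α (jointLaw P (X s) (X t)) Γ ∧
      mixedMoment Γ = 1 / (α * lam) * ‖(!₂[1, Real.exp (-lam * (t - s))] : EuclideanSpace ℝ (Fin 2))‖
        ^ (α - 2) * Real.exp (-lam * (t - s)) := by
  have hnn := one_sub_exp_rpow_nonneg hα hlam (sub_nonneg.2 hst)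
  have hal : 0 < α * lam := mul_pos hα hlam
  obtain ⟨Γ, hΓ, hΓm⟩ := exists_isSpectralMeasure_of_two_atoms (α := α)
    (ν := jointLaw P (X s) (X t)) (x := !₂[1, Real.exp (-lam * (t - s))]) (y := !₂[0, 1])
    (A := 1 / (α * lam)) (B := 1 / (α * lam) * (1 - Real.exp (-lam * (t - s)) ^ α))
    (fun h => by simpa using congrArg (fun z : EuclideanSpace ℝ (Fin 2) => z 0) h)
    (fun h => by simpa using congrArg (fun z : EuclideanSpace ℝ (Fin 2) => z 1) h)
    (by positivity) (by positivity) (fun z => by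
      rw [IsStableIntegral.charFun_jointLaw_eq hX.randomMeasure hα (hX.integral s) (hX.integral t),
        integral_abs_lin_comb_ouKernel_rpow hα hlam hst]
      simp [inner_plane])
  refine ⟨Γ, hΓ, ?_⟩
  simpa using hΓm

theorem IsStableOU.isSymmStable_jointLaw (hX : IsStableOU α lam P M X) (hα : 0 < α)
    (hlam : 0 < lam) (s t : ℝ) : IsSymmStable α (jointLaw P (X s) (X t)) := by
  rcases le_total s t with hst | hst
  · obtain ⟨Γ, hΓ, -⟩ := hX.exists_isSpectralMeasure hα hlam hst
    exact ⟨Γ, hΓ⟩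
  · have hnn := one_sub_exp_rpow_nonneg hα hlam (sub_nonneg.2 hst)
    have hal : 0 < α * lam := mul_pos hα hlam
    -- Here X(t) is the earlier variable, so the coordinates of both atoms are exchanged.
    obtain ⟨Γ, hΓ, -⟩ := exists_isSpectralMeasure_of_two_atoms (α := α)
      (ν := jointLaw P (X s) (X t)) (x := !₂[Real.exp (-lam * (s - t)), 1]) (y := !₂[1, 0])
      (A := 1 / (α * lam)) (B := 1 / (α * lam) * (1 - Real.exp (-lam * (s - t)) ^ α))
      (fun h => by simpa using congrArg (fun z : EuclideanSpace ℝ (Fin 2) => z 1) h)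
      (fun h => by simpa using congrArg (fun z : EuclideanSpace ℝ (Fin 2) => z 0) h)
      (by positivity) (by positivity) (fun z => by
        rw [IsStableIntegral.charFun_jointLaw_eq hX.randomMeasure hα (hX.integral s)
          (hX.integral t)]
        simp only [add_comm (z 0 * ouKernel lam s _)]
        rw [integral_abs_lin_comb_ouKernel_rpow hα hlam hst]
        simp [inner_plane, add_comm])
    exact ⟨Γ, hΓ⟩

/-- The case t = 0 is included because the normalisation divides by ρ(0). -/
theorem IsStableOU.alphaCovFun_eq (hX : IsStableOU α lam P M X) (hα : 0 < α)
    (hlam : 0 < lam) {t : ℝ} (ht : 0 ≤ t) :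
    alphaCovFun α P X t =
      1 / (α * lam * (1 + Real.exp (-2 * lam * t)) ^ ((2 - α) / 2)) * Real.exp (-lam * t) := by
  obtain ⟨Γ, hΓ, hm⟩ := hX.exists_isSpectralMeasure hα hlam ht
  have hsq : Real.exp (-2 * lam * t) = Real.exp (-lam * t) ^ 2 := by
    rw [← Real.exp_nat_mul]
    congr 1
    push_cast
    ring
  rw [alphaCovFun, alphaCovariance, ← mixedMoment_spectralMeasure hα hΓ, hm, sub_zero,
    EuclideanSpace.norm_eq, Fin.sum_univ_two, Real.sqrt_eq_rpow, ← Real.rpow_mul (by positivity)]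
  simp only [Matrix.cons_val_zero, Matrix.cons_val_one, Real.norm_eq_abs, sq_abs,
    one_pow, ← hsq]
  rw [show 1 / 2 * (α - 2) = -((2 - α) / 2) by ring, Real.rpow_neg (by positivity)]
  field_simp

theorem IsStableOU.normAlphaCovFun_eq (hX : IsStableOU α lam P M X) (hα : 0 < α)
    (hlam : 0 < lam) {t : ℝ} (ht : 0 ≤ t) :
    normAlphaCovFun α P X t =
      1 / (2⁻¹ * (1 + Real.exp (-2 * lam * t))) ^ ((2 - α) / 2) * Real.exp (-lam * t) := by
  rw [normAlphaCovFun, hX.alphaCovFun_eq hα hlam ht, hX.alphaCovFun_eq hα hlam le_rfl,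
    Real.mul_rpow (by norm_num) (by positivity), Real.inv_rpow (by norm_num)]
  simp only [mul_zero, Real.exp_zero, mul_one, one_add_one_eq_two]
  have h2 : (0 : ℝ) < 2 ^ ((2 - α) / 2) := by positivity
  have h3 : 0 < (1 + Real.exp (-2 * lam * t)) ^ ((2 - α) / 2) := by positivity
  field_simp

end OrnsteinUhlenbeck

/-! ### The main theorem and the asymptotics. -/

theorem proposition6 {Ω : Type*} [MeasurableSpace Ω] (P : Measure Ω) [IsProbabilityMeasure P]
    (α lam : ℝ) (hα0 : 0 < α) (hα2 : α ≤ 2) (hlam : 0 < lam)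
    (M : Set ℝ → Ω → ℝ) (X : ℝ → Ω → ℝ) (hX : IsStableOU α lam P M X) :
    -- the pairs `(X 0, X t)` are symmetric `α`-stable, and `ρ(t)` is `∫ s₁ s₂ Γ(ds)` whichever
    -- spectral measure `Γ` is taken
    (∀ t : ℝ, IsSymmStable α (jointLaw P (X 0) (X t)) ∧
      ∀ Γ : Measure (UnitSphere 2), IsSpectralMeasure α (jointLaw P (X 0) (X t)) Γ →
        mixedMoment Γ = alphaCovFun α P X t) ∧
    (∀ t : ℝ, 0 < t →
      alphaCovFun α P X t =
        1 / (α * lam * (1 + Real.exp (-2 * lam * t)) ^ ((2 - α) / 2)) * Real.exp (-lam * t)) ∧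
    (∀ t : ℝ, 0 < t →
      normAlphaCovFun α P X t =
        1 / (2⁻¹ * (1 + Real.exp (-2 * lam * t))) ^ ((2 - α) / 2) * Real.exp (-lam * t)) ∧
    (normAlphaCovFun α P X) ~[atTop]
      (fun t : ℝ => (2 : ℝ) ^ ((2 - α) / 2) * Real.exp (-lam * t)) := by
  refine ⟨fun t => ⟨hX.isSymmStable_jointLaw hα0 hlam 0 t,
    fun Γ hΓ => mixedMoment_spectralMeasure hα0 hΓ⟩, fun t ht => hX.alphaCovFun_eq hα0 hlam ht.le,
    fun t ht => hX.normAlphaCovFun_eq hα0 hlam ht.le, ?_⟩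
  have hexp : Tendsto (fun t => Real.exp (-2 * lam * t)) atTop (𝓝 0) :=
    Real.tendsto_exp_atBot.comp (tendsto_id.const_mul_atTop_of_neg (by linarith))
  have hlim : Tendsto (fun t => ((1 + Real.exp (-2 * lam * t)) ^ ((2 - α) / 2))⁻¹) atTop (𝓝 1) := by
    have h := ((hexp.const_add 1).rpow_const (p := (2 - α) / 2) (Or.inl (by norm_num))).inv₀
      (by simp)
    simpa using h
  -- The ratio of the two sides is exactly (1 + e^{-2λt})^{-(2-α)/2} for t ≥ 0.
  refine (isEquivalent_iff_exists_eq_mul.2 ⟨_, hlim, ?_⟩)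
  filter_upwards [eventually_ge_atTop 0] with t ht
  rw [hX.normAlphaCovFun_eq hα0 hlam ht, Pi.mul_apply,
    Real.mul_rpow (by norm_num) (by positivity), Real.inv_rpow (by norm_num)]
  have h2 : (0 : ℝ) < 2 ^ ((2 - α) / 2) := by positivity
  have h3 : 0 < (1 + Real.exp (-2 * lam * t)) ^ ((2 - α) / 2) := by positivity
  field_simp
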